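/- Let $F$ be an algebraically closed field of characteristic $5$. Let $\mathcal O=\mathcal O(2;(1,1))$ be the divided power algebra over $F$ with basis $x_1^{(a)}x_2^{(b)}$ $(0\le a,b\le 4)$, product $x_1^{(a)}x_2^{(b)}\cdot x_1^{(c)}x_2^{(d)}=\binom{a+c}{a}\binom{b+d}{b}x_1^{(a+c)}x_2^{(b+d)}$ (read as $0$ if $a+c>4$ or $b+d>4$), and derivations $\partial_1,\partial_2$ given by $\partial_1(x_1^{(a)}x_2^{(b)})=x_1^{(a-1)}x_2^{(b)}$, $\partial_2(x_1^{(a)}x_2^{(b)})=x_1^{(a)}x_2^{(b-1)}$ (with $x_i^{(-1)}=0$). Let $W=\mathcal O\partial_1\oplus\mathcal O\partial_2$ with the commutator bracket of derivations, let $\mathrm{div}(u_1\partial_1+u_2\partial_2)=\partial_1(u_1)+\partial_2(u_2)$, and let $\widetilde W=\{\widetilde E: E\in W\}$ be a second copy of the vector space $W$. The restricted Melikian algebra is the $125$-dimensional Lie algebra $\mathcal M=\mathcal M(1,1)=\mathcal O\oplus W\oplus\widetilde W$ whose (anticommutative) bracket extends that of $W$ and satisfies, for $D,E\in W$ and $f,g,u_i,v_i\in\mathcal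 O$, $$[D,\widetilde E]=\widetilde{[D,E]}+2\,\mathrm{div}(D)\widetilde E,\qquad [D,f]=D(f)-2\,\mathrm{div}(D)f,\qquad [f,\widetilde E]=fE,$$ $$[f,g]=2\,(f\widetilde{D_g}-g\widetilde{D_f}),\quad D_f=\partial_1(f)\partial_2-\partial_2(f)\partial_1,\qquad [\widetilde{u_1\partial_1+u_2\partial_2},\widetilde{v_1\partial_1+v_2\partial_2}]=u_1v_2-u_2v_1 .$$ Then $\mathcal M$ has no nontrivial central extensions. Precisely: 1. $H^2(\mathcal M,F)=0$, where $F$ is the trivial $\mathcal M$-module. 2. Every central extension of $\mathcal M$ splits: if $p:E\to\mathcal M$ is a surjective homomorphism of Lie algebras over $F$ whose kernel lies in the center of $E$, then there is a Lie algebra homomorphism $s:\mathcal M\to E$ with $p\circ s=\mathrm{id}_{\mathcal M}$. 3. If $\widetilde{\mathcal M}$ is a Lie algebra over $F$ with center $\mathfrak z$ and $\widetilde{\mathcal M}/\mathfrak z\cong\mathcal M$, then $\widetilde{\mathcal M}^{(1)}=[\widetilde{\mathcal M},\widetilde{\mathcal M}]\cong\mathcal M$ and $\widetilde{\mathcal M}=\widetilde{\mathcal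 M}^{(1)}\oplus\mathfrak z$. -/

import Mathlib

/-! ## The truncated divided power algebra in two variables over a ring of characteristic `5` -/

/-- The divided power algebra `𝒪(2; (1,1))` over `F`, in characteristic `5`. It has the basis
`x₁^(a) x₂^(b)` with `0 ≤ a, b ≤ 4`; an element is the family of its coefficients, so that
`f : DivPow F` stands for `∑ f (a, b) x₁^(a) x₂^(b)`. -/
def DivPow (F : Type*) : Type _ := Fin 5 × Fin 5 → F

namespace DivPow

variable {F : Type*}

@[ext] theorem ext {f g : DivPow F} (h : ∀ c, f c = g c) : f = g := funext h

/-- The basis monomial `x₁^(a) x₂^(b)`. -/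
def mono [Zero F] [One F] (a b : Fin 5) : DivPow F := fun c => if c = (a, b) then 1 else 0

instance [AddCommGroup F] : AddCommGroup (DivPow F) :=
  inferInstanceAs (AddCommGroup (Fin 5 × Fin 5 → F))

instance [CommRing F] : Module F (DivPow F) :=
  inferInstanceAs (Module F (Fin 5 × Fin 5 → F))

theorem add_apply [AddCommGroup F] (f g : DivPow F) (c) : (f + g) c = f c + g c := rfl
theorem zero_apply [AddCommGroup F] (c) : (0 : DivPow F) c = 0 := rfl
theorem smul_apply [CommRing F] (r : F) (f : DivPow F) (c) : (r • f) c = r * f c := rfl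

/-- The coefficient `binom(c₁, a₁) binom(c₂, a₂)`; it vanishes unless `a ≤ c`. -/
def binom (c a : Fin 5 × Fin 5) : ℕ := Nat.choose c.1 a.1 * Nat.choose c.2 a.2

/-- The unit `x₁^(0) x₂^(0)`. -/
instance [CommRing F] : One (DivPow F) := ⟨mono 0 0⟩

/-- The product `x^(a) x^(b) = binom(a + b, a) x^(a + b)`, which is `0` if `a + b` has an entry
greater than `4`. In the sum, the terms in which `a ≤ c` fails have coefficient `0`, so the
wrap-around of `c - a` in `Fin 5` plays no role. -/
instance [CommRing F] : Mul (DivPow F) :=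
  ⟨fun f g c => ∑ a : Fin 5 × Fin 5, (binom c a : F) * f a * g (c - a)⟩

theorem mul_apply [CommRing F] (f g : DivPow F) (c) :
    (f * g) c = ∑ a : Fin 5 × Fin 5, (binom c a : F) * f a * g (c - a) := rfl

theorem one_apply [CommRing F] (c : Fin 5 × Fin 5) :
    (1 : DivPow F) c = if c = 0 then 1 else 0 := rfl

theorem choose_sub (c a : Fin 5) :
    Nat.choose c.val (c - a).val = Nat.choose c.val a.val := by
  revert c a; decide

theorem choose_mul_choose (c a b : Fin 5) :
    Nat.choose c.val a.val * Nat.choose a.val b.val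
      = Nat.choose c.val b.val * Nat.choose (c - b).val (a - b).val := by
  revert c a b; decide

theorem binom_sub (c a : Fin 5 × Fin 5) : binom c (c - a) = binom c a := by
  simp only [binom, Prod.fst_sub, Prod.snd_sub, choose_sub]

theorem binom_mul_binom (c a b : Fin 5 × Fin 5) :
    binom c a * binom a b = binom c b * binom (c - b) (a - b) := by
  have h1 := choose_mul_choose c.1 a.1 b.1
  have h2 := choose_mul_choose c.2 a.2 b.2
  simp only [binom, Prod.fst_sub, Prod.snd_sub]
  calc _ = (Nat.choose c.1 a.1 * Nat.choose a.1 b.1)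
        * (Nat.choose c.2 a.2 * Nat.choose a.2 b.2) := by ring
    _ = _ := by rw [h1, h2]; ring

section Ring

variable [CommRing F]

theorem dp_mul_comm (f g : DivPow F) : f * g = g * f := by
  ext c
  rw [mul_apply, mul_apply, ← Equiv.sum_comp (Equiv.subLeft c)]
  refine Finset.sum_congr rfl fun a _ => ?_
  simp only [Equiv.subLeft_apply, binom_sub, sub_sub_cancel]
  ring

theorem dp_mul_assoc (f g h : DivPow F) : f * g * h = f * (g * h) := by
  ext c
  simp only [mul_apply, Finset.mul_sum, Finset.sum_mul]
  rw [Finset.sum_comm]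
  refine Finset.sum_congr rfl fun b _ => ?_
  rw [← Equiv.sum_comp (Equiv.subRight b)
    (fun a => (binom c b : F) * f b * ((binom (c - b) a : F) * g a * h (c - b - a)))]
  refine Finset.sum_congr rfl fun a _ => ?_
  have hb : (binom c a : F) * binom a b = binom c b * binom (c - b) (a - b) := by
    exact_mod_cast congrArg (Nat.cast (R := F)) (binom_mul_binom c a b)
  have hs : c - b - (a - b) = c - a := by abel
  simp only [Equiv.subRight_apply, hs]
  linear_combination f b * g (a - b) * h (c - a) * hb

theorem dp_one_mul (f : DivPow F) : 1 * f = f := by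
  ext c
  rw [mul_apply, Finset.sum_eq_single 0]
  · simp [one_apply, binom]
  · intro a _ ha
    simp [one_apply, ha]
  · simp

theorem dp_left_distrib (f g h : DivPow F) : f * (g + h) = f * g + f * h := by
  ext c
  simp only [mul_apply, add_apply, ← Finset.sum_add_distrib]
  exact Finset.sum_congr rfl fun a _ => by ring

instance : CommRing (DivPow F) where
  __ := (inferInstance : AddCommGroup (DivPow F))
  mul_assoc := dp_mul_assoc
  mul_comm := dp_mul_comm
  one_mul := dp_one_mul
  mul_one f := by rw [dp_mul_comm, dp_one_mul]
  left_distrib := dp_left_distrib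
  right_distrib f g h := by
    rw [dp_mul_comm, dp_left_distrib, dp_mul_comm h f, dp_mul_comm h g]
  zero_mul f := by ext c; simp [mul_apply, zero_apply]
  mul_zero f := by ext c; simp [mul_apply, zero_apply]

theorem dp_smul_mul (r : F) (f g : DivPow F) : r • f * g = r • (f * g) := by
  ext c
  simp only [mul_apply, smul_apply, Finset.mul_sum]
  exact Finset.sum_congr rfl fun a _ => by ring

theorem dp_mul_smul (r : F) (f g : DivPow F) : f * r • g = r • (f * g) := by
  rw [mul_comm, dp_smul_mul, mul_comm]

instance : Algebra F (DivPow F) := Algebra.ofModule dp_smul_mul dp_mul_smul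

/-- The derivation `∂₁` of `𝒪(2; (1,1))`: `∂₁ (x₁^(a) x₂^(b)) = x₁^(a - 1) x₂^(b)`. -/
def d₁ : DivPow F →ₗ[F] DivPow F where
  toFun f c := if c.1 = 4 then 0 else f (c.1 + 1, c.2)
  map_add' f g := by
    ext c
    change (if c.1 = 4 then (0 : F) else _) =
      (if c.1 = 4 then (0 : F) else _) + (if c.1 = 4 then (0 : F) else _)
    by_cases h : c.1 = 4 <;> simp [add_apply, h]
  map_smul' r f := by
    ext c
    change (if c.1 = 4 then 0 else _) = r * (if c.1 = 4 then 0 else _)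
    by_cases h : c.1 = 4 <;> simp [smul_apply, h]

/-- The derivation `∂₂` of `𝒪(2; (1,1))`: `∂₂ (x₁^(a) x₂^(b)) = x₁^(a) x₂^(b - 1)`. -/
def d₂ : DivPow F →ₗ[F] DivPow F where
  toFun f c := if c.2 = 4 then 0 else f (c.1, c.2 + 1)
  map_add' f g := by
    ext c
    change (if c.2 = 4 then (0 : F) else _) =
      (if c.2 = 4 then (0 : F) else _) + (if c.2 = 4 then (0 : F) else _)
    by_cases h : c.2 = 4 <;> simp [add_apply, h]
  map_smul' r f := by
    ext c
    change (if c.2 = 4 then 0 else _) = r * (if c.2 = 4 then 0 else _)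
    by_cases h : c.2 = 4 <;> simp [smul_apply, h]

theorem d₁_apply (f : DivPow F) (c) : d₁ f c = if c.1 = 4 then 0 else f (c.1 + 1, c.2) := rfl
theorem d₂_apply (f : DivPow F) (c) : d₂ f c = if c.2 = 4 then 0 else f (c.1, c.2 + 1) := rfl

theorem d₁_d₂ (f : DivPow F) : d₁ (d₂ f) = d₂ (d₁ f) := by
  ext c
  simp only [d₁_apply, d₂_apply]
  split_ifs <;> rfl

theorem choose_leibniz (c a : Fin 5) :
    (if c = 4 then 0 else (Nat.choose (c + 1).val a.val : ZMod 5))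
      = (if a = 0 then 0 else (Nat.choose c.val (a - 1).val : ZMod 5))
        + if c - a = 4 then 0 else (Nat.choose c.val a.val : ZMod 5) := by
  revert c a; decide

theorem choose_leibniz_cast [CharP F 5] (c a : Fin 5) :
    (if c = 4 then 0 else (Nat.choose (c + 1).val a.val : F))
      = (if a = 0 then 0 else (Nat.choose c.val (a - 1).val : F))
        + if c - a = 4 then 0 else (Nat.choose c.val a.val : F) := by
  have h := congrArg (ZMod.castHom (dvd_refl 5) F) (choose_leibniz c a)
  simpa only [map_add, apply_ite (ZMod.castHom (dvd_refl 5) F), map_zero, map_natCast] using h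

theorem sub_one_eq_four (a : Fin 5) : a - 1 = 4 ↔ a = 0 := by
  revert a; decide

theorem d₁_mul [CharP F 5] (f g : DivPow F) : d₁ (f * g) = d₁ f * g + f * d₁ g := by
  ext c
  obtain ⟨c1, c2⟩ := c
  have key : ∀ a : Fin 5 × Fin 5,
      (if c1 = 4 then 0 else (Nat.choose (c1 + 1).val a.1.val : F))
        * Nat.choose c2.val a.2.val * f a * g ((c1 + 1, c2) - a)
      = (binom (c1, c2) (a - (1, 0)) : F) * d₁ f (a - (1, 0)) * g ((c1, c2) - (a - (1, 0)))
        + (binom (c1, c2) a : F) * f a * d₁ g ((c1, c2) - a) := by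
    rintro ⟨a1, a2⟩
    have e1 : (c1, c2) - ((a1, a2) - ((1 : Fin 5), (0 : Fin 5))) = (c1 + 1, c2) - (a1, a2) := by
      ext1 <;> simp; abel
    have e2 : c1 - a1 + 1 = c1 + 1 - a1 := by abel
    have e3 : a1 - 1 = 4 ↔ a1 = 0 := sub_one_eq_four a1
    rw [choose_leibniz_cast, e1]
    simp only [d₁_apply, binom, Prod.mk_sub_mk, sub_zero, sub_add_cancel, e2, e3]
    split_ifs <;> push_cast <;> ring
  have h : (d₁ (f * g)) (c1, c2) = ∑ a : Fin 5 × Fin 5,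
      (if c1 = 4 then 0 else (Nat.choose (c1 + 1).val a.1.val : F))
        * Nat.choose c2.val a.2.val * f a * g ((c1 + 1, c2) - a) := by
    rw [d₁_apply]
    by_cases hc : c1 = 4 <;> simp [hc, mul_apply, binom]
  rw [h, Finset.sum_congr rfl fun a _ => key a, Finset.sum_add_distrib, add_apply, mul_apply,
    mul_apply]
  congr 1
  exact Equiv.sum_comp (Equiv.subRight ((1 : Fin 5), (0 : Fin 5)))
    (fun a => (binom (c1, c2) a : F) * d₁ f a * g ((c1, c2) - a))

theorem d₂_mul [CharP F 5] (f g : DivPow F) : d₂ (f * g) = d₂ f * g + f * d₂ g := by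
  ext c
  obtain ⟨c1, c2⟩ := c
  have key : ∀ a : Fin 5 × Fin 5,
      (if c2 = 4 then 0 else (Nat.choose (c2 + 1).val a.2.val : F))
        * Nat.choose c1.val a.1.val * f a * g ((c1, c2 + 1) - a)
      = (binom (c1, c2) (a - (0, 1)) : F) * d₂ f (a - (0, 1)) * g ((c1, c2) - (a - (0, 1)))
        + (binom (c1, c2) a : F) * f a * d₂ g ((c1, c2) - a) := by
    rintro ⟨a1, a2⟩
    have e1 : (c1, c2) - ((a1, a2) - ((0 : Fin 5), (1 : Fin 5))) = (c1, c2 + 1) - (a1, a2) := by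
      ext1 <;> simp; abel
    have e2 : c2 - a2 + 1 = c2 + 1 - a2 := by abel
    have e3 : a2 - 1 = 4 ↔ a2 = 0 := sub_one_eq_four a2
    rw [choose_leibniz_cast, e1]
    simp only [d₂_apply, binom, Prod.mk_sub_mk, sub_zero, sub_add_cancel, e2, e3]
    split_ifs <;> push_cast <;> ring
  have h : (d₂ (f * g)) (c1, c2) = ∑ a : Fin 5 × Fin 5,
      (if c2 = 4 then 0 else (Nat.choose (c2 + 1).val a.2.val : F))
        * Nat.choose c1.val a.1.val * f a * g ((c1, c2 + 1) - a) := by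
    rw [d₂_apply]
    by_cases hc : c2 = 4
    · simp [hc]
    · simp only [hc, if_false, mul_apply, binom]
      exact Finset.sum_congr rfl fun a _ => by push_cast; ring
  rw [h, Finset.sum_congr rfl fun a _ => key a, Finset.sum_add_distrib, add_apply, mul_apply,
    mul_apply]
  congr 1
  exact Equiv.sum_comp (Equiv.subRight ((0 : Fin 5), (1 : Fin 5)))
    (fun a => (binom (c1, c2) a : F) * d₂ f a * g ((c1, c2) - a))

instance [CharP F 5] : CharP (DivPow F) 5 :=
  charP_of_injective_algebraMap (R := F) (fun r s h => by
    have h0 := congrFun h 0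
    simpa [Algebra.algebraMap_eq_smul_one, smul_apply, one_apply] using h0) 5

theorem d₁_two [CharP F 5] : d₁ (2 : DivPow F) = 0 := by
  have h := d₁_mul (1 : DivPow F) 1
  have h1 : d₁ (1 : DivPow F) = 0 := by simpa using h
  rw [← one_add_one_eq_two, map_add, h1, add_zero]

theorem d₂_two [CharP F 5] : d₂ (2 : DivPow F) = 0 := by
  have h := d₂_mul (1 : DivPow F) 1
  have h1 : d₂ (1 : DivPow F) = 0 := by simpa using h
  rw [← one_add_one_eq_two, map_add, h1, add_zero]

end Ring

end DivPow

/-- `W(2; (1,1))`: the pair `(u₁, u₂)` stands for the derivation `u₁ ∂₁ + u₂ ∂₂` of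
`𝒪(2; (1,1))`. -/
abbrev WittAlg (F : Type*) : Type _ := DivPow F × DivPow F

namespace WittAlg

open DivPow

variable {F : Type*} [CommRing F]

/-- The action `D(f) = u₁ ∂₁(f) + u₂ ∂₂(f)` of `D = u₁ ∂₁ + u₂ ∂₂` on `𝒪(2; (1,1))`. -/
def app (D : WittAlg F) (f : DivPow F) : DivPow F := D.1 * d₁ f + D.2 * d₂ f

/-- The divergence `div(u₁ ∂₁ + u₂ ∂₂) = ∂₁(u₁) + ∂₂(u₂)`. -/
def div (D : WittAlg F) : DivPow F := d₁ D.1 + d₂ D.2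

/-- The commutator `[D, E]` of derivations. -/
def brak (D E : WittAlg F) : WittAlg F :=
  (D.app E.1 - E.app D.1, D.app E.2 - E.app D.2)

/-- The derivation `D_f = ∂₁(f) ∂₂ - ∂₂(f) ∂₁`. -/
def ham (f : DivPow F) : WittAlg F := (-d₂ f, d₁ f)

end WittAlg

/-- The restricted Melikian algebra `ℳ(1,1) = 𝒪(2; (1,1)) ⊕ W(2; (1,1)) ⊕ W(2; (1,1))~` over a
field `F` of characteristic `5`. The triple `(f, D, E)` stands for `f + D + E~`, where `E~` is
the copy of `E` in the second copy `W(2; (1,1))~` of the space `W(2; (1,1))`. -/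
def Melikian (F : Type*) : Type _ := DivPow F × WittAlg F × WittAlg F

namespace Melikian

open DivPow WittAlg

variable {F : Type*}

instance [CommRing F] : AddCommGroup (Melikian F) :=
  inferInstanceAs (AddCommGroup (DivPow F × WittAlg F × WittAlg F))

instance [CommRing F] : Module F (Melikian F) :=
  inferInstanceAs (Module F (DivPow F × WittAlg F × WittAlg F))

/-- The component in `𝒪(2; (1,1))`. -/
def fn (x : Melikian F) : DivPow F := x.1

/-- The component in `W(2; (1,1))`. -/
def vec (x : Melikian F) : WittAlg F := x.2.1

/-- The component in `W(2; (1,1))~`. -/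
def til (x : Melikian F) : WittAlg F := x.2.2

theorem ext_comp {x y : Melikian F} (h0 : x.fn = y.fn) (h1 : x.vec.1 = y.vec.1)
    (h2 : x.vec.2 = y.vec.2) (h3 : x.til.1 = y.til.1) (h4 : x.til.2 = y.til.2) : x = y :=
  Prod.ext h0 (Prod.ext (Prod.ext h1 h2) (Prod.ext h3 h4))

section Ring

variable [CommRing F]

/-- The bracket of `ℳ(1,1)`. On `W(2; (1,1))` it is the commutator of derivations, and for
`D, E ∈ W(2; (1,1))`, `f, g ∈ 𝒪(2; (1,1))`,
* `[D, E~] = [D, E]~ + 2 div(D) E~`,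
* `[D, f] = D(f) - 2 div(D) f`,
* `[f, E~] = f E`,
* `[f, g] = 2 (f D_g - g D_f)~` with `D_f = ∂₁(f) ∂₂ - ∂₂(f) ∂₁`,
* `[(u₁ ∂₁ + u₂ ∂₂)~, (v₁ ∂₁ + v₂ ∂₂)~] = u₁ v₂ - u₂ v₁`. -/
instance : Bracket (Melikian F) (Melikian F) where
  bracket x y :=
    ( (x.vec.app y.fn - 2 * x.vec.div * y.fn) - (y.vec.app x.fn - 2 * y.vec.div * x.fn)
        + (x.til.1 * y.til.2 - x.til.2 * y.til.1),
      x.vec.brak y.vec + x.fn • y.til - y.fn • x.til,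
      (x.vec.brak y.til + (2 * x.vec.div) • y.til) - (y.vec.brak x.til + (2 * y.vec.div) • x.til)
        + (2 : DivPow F) • (x.fn • ham y.fn - y.fn • ham x.fn) )

theorem add_fn (x y : Melikian F) : (x + y).fn = x.fn + y.fn := rfl
theorem add_vec (x y : Melikian F) : (x + y).vec = x.vec + y.vec := rfl
theorem add_til (x y : Melikian F) : (x + y).til = x.til + y.til := rfl
theorem zero_fn : (0 : Melikian F).fn = 0 := rfl
theorem zero_vec : (0 : Melikian F).vec = 0 := rfl
theorem zero_til : (0 : Melikian F).til = 0 := rfl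
theorem smul_fn (r : F) (x : Melikian F) : (r • x).fn = r • x.fn := rfl
theorem smul_vec (r : F) (x : Melikian F) : (r • x).vec = r • x.vec := rfl
theorem smul_til (r : F) (x : Melikian F) : (r • x).til = r • x.til := rfl

theorem lie_fn (x y : Melikian F) : ⁅x, y⁆.fn =
    (x.vec.app y.fn - 2 * x.vec.div * y.fn) - (y.vec.app x.fn - 2 * y.vec.div * x.fn)
      + (x.til.1 * y.til.2 - x.til.2 * y.til.1) := rfl

theorem lie_vec (x y : Melikian F) : ⁅x, y⁆.vec =
    x.vec.brak y.vec + x.fn • y.til - y.fn • x.til := rfl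

theorem lie_til (x y : Melikian F) : ⁅x, y⁆.til =
    (x.vec.brak y.til + (2 * x.vec.div) • y.til) - (y.vec.brak x.til + (2 * y.vec.div) • x.til)
      + (2 : DivPow F) • (x.fn • ham y.fn - y.fn • ham x.fn) := rfl

theorem mel_add_lie (x y z : Melikian F) : ⁅x + y, z⁆ = ⁅x, z⁆ + ⁅y, z⁆ := by
  apply ext_comp <;>
  simp only [lie_fn, lie_vec, lie_til, add_fn, add_vec, add_til, app, div, brak, ham, Prod.fst_add,
    Prod.snd_add, Prod.fst_sub, Prod.snd_sub, Prod.smul_fst, Prod.smul_snd, smul_eq_mul,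
    map_add] <;> ring

theorem mel_lie_self (x : Melikian F) : ⁅x, x⁆ = 0 := by
  apply ext_comp <;>
  simp only [lie_fn, lie_vec, lie_til, zero_fn, zero_vec, zero_til, app, div, brak, ham,
    Prod.fst_add, Prod.snd_add, Prod.fst_sub, Prod.snd_sub, Prod.smul_fst, Prod.smul_snd,
    Prod.fst_zero, Prod.snd_zero, smul_eq_mul] <;> ring

theorem mel_lie_add (x y z : Melikian F) : ⁅x, y + z⁆ = ⁅x, y⁆ + ⁅x, z⁆ := by
  apply ext_comp <;>
  simp only [lie_fn, lie_vec, lie_til, add_fn, add_vec, add_til, app, div, brak, ham, Prod.fst_add,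
    Prod.snd_add, Prod.fst_sub, Prod.snd_sub, Prod.smul_fst, Prod.smul_snd, smul_eq_mul,
    map_add] <;> ring

theorem mel_lie_smul (r : F) (x y : Melikian F) : ⁅x, r • y⁆ = r • ⁅x, y⁆ := by
  apply ext_comp <;>
  simp only [lie_fn, lie_vec, lie_til, smul_fn, smul_vec, smul_til, app, div, brak, ham,
    Prod.fst_add, Prod.snd_add, Prod.fst_sub, Prod.snd_sub, Prod.smul_fst, Prod.smul_snd,
    smul_eq_mul, map_smul] <;>
  simp only [Algebra.smul_def] <;> ring

set_option maxHeartbeats 1000000 in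
theorem mel_leibniz [CharP F 5] (x y z : Melikian F) :
    ⁅x, ⁅y, z⁆⁆ = ⁅⁅x, y⁆, z⁆ + ⁅y, ⁅x, z⁆⁆ := by
  have h5 : (5 : DivPow F) = 0 := by exact_mod_cast CharP.cast_eq_zero (DivPow F) 5
  have h10 : (10 : DivPow F) = 0 := by linear_combination 2 * h5
  apply ext_comp <;> rw [← sub_eq_zero] <;>
  simp only [lie_fn, lie_vec, lie_til, add_fn, add_vec, add_til, app, div, brak, ham,
    Prod.fst_add, Prod.snd_add, Prod.fst_sub, Prod.snd_sub, Prod.smul_fst, Prod.smul_snd,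
    smul_eq_mul, map_add, map_sub, map_neg, d₁_mul, d₂_mul, d₁_two, d₂_two, d₁_d₂] <;>
  ring_nf <;>
  simp only [h5, h10, mul_zero, neg_zero, add_zero, sub_zero]

instance [CharP F 5] : LieRing (Melikian F) where
  add_lie := mel_add_lie
  lie_add := mel_lie_add
  lie_self := mel_lie_self
  leibniz_lie := mel_leibniz

instance [CharP F 5] : LieAlgebra F (Melikian F) where
  lie_smul := mel_lie_smul

end Ring

end Melikian

/-- The space `B²(L, V)` of coboundaries of `1`-cochains, in the space of bilinear maps. -/
def LieB2 (R L V : Type*) [CommRing R] [LieRing L] [LieAlgebra R L] [AddCommGroup V]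
    [Module R V] [LieRingModule L V] [LieModule R L V] : Submodule R (L →ₗ[R] L →ₗ[R] V) :=
  (LinearMap.range (LieModule.Cohomology.d₁₂ R L V)).map
    (LieModule.Cohomology.twoCochain R L V).subtype

/-- The space `Z²(L, V)` of alternating `2`-cocycles, in the space of bilinear maps. -/
def LieZ2 (R L V : Type*) [CommRing R] [LieRing L] [LieAlgebra R L] [AddCommGroup V]
    [Module R V] [LieRingModule L V] [LieModule R L V] : Submodule R (L →ₗ[R] L →ₗ[R] V) :=
  (LieModule.Cohomology.twoCocycle R L V).map (LieModule.Cohomology.twoCochain R L V).subtype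

/-- The second cohomology group `H²(L, V) = Z²(L, V) / B²(L, V)` of a Lie algebra `L` over `R`
with coefficients in an `L`-module `V`, realised inside the quotient of the space of all bilinear
maps by `B²(L, V)`. -/
def LieH2 (R L V : Type*) [CommRing R] [LieRing L] [LieAlgebra R L] [AddCommGroup V]
    [Module R V] [LieRingModule L V] [LieModule R L V] :
    Submodule R ((L →ₗ[R] L →ₗ[R] V) ⧸ LieB2 R L V) :=
  (LieZ2 R L V).map (LieB2 R L V).mkQ

/-! Everything reduces to one statement, `exists_eq_lie`: a 2-cocycle `ω` on `ℳ` with values in any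
vector space with trivial action is a coboundary. The tool is the radical of `ω`, the set of `x`
with `ω x = 0`. It is a subalgebra, and `ω` is invariant under it.

The torus spanned by `x₁ ∂₁` and `x₂ ∂₂` acts diagonally on the monomial basis. A coboundary can be
subtracted so that `ω` pairs only weights with sum zero mod 5 and the radical contains `∂₁` and `∂₂`
(`exists_normalized`, `d₁_mem_radical`, `d₂_mem_radical`). Invariance under `∂₁` and `∂₂` lets
exponents move from one argument to the other at the cost of a sign. Hence `ω` vanishes on two
monomials whose exponents in some variable add up to less than 4, and for totals exactly `(4, 4)`
all values reduce to one. Together with the weights this puts a few monomials of small degree into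
the radical (`mem_radical_of_isLow`).

Brackets of these produce the top monomial of each of the five copies of `𝒪` (`top_mem_radical`),
and `∂₁`, `∂₂` lower the top monomials to all the others. So the radical is `ℳ` and `ω = 0`.

For a central extension, the cocycle is the failure of a linear section to be a homomorphism. The
statement on the derived algebra follows because `ℳ` is perfect. -/

/-! ### Monomials of the divided power algebra -/

namespace DivPow

variable {F : Type*} [CommRing F]

/-- The monomial `x₁^(a) x₂^(b)`, read as `0` if `a` or `b` exceeds `4`. -/
def X (F : Type*) [CommRing F] (a b : ℕ) : DivPow F :=
  fun c => if c.1.val = a ∧ c.2.val = b then 1 else 0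

theorem X_apply (a b : ℕ) (c : Fin 5 × Fin 5) :
    X F a b c = if c.1.val = a ∧ c.2.val = b then 1 else 0 := rfl

theorem X_zero_zero : X F 0 0 = 1 := by
  ext c
  have h : (c.1.val = 0 ∧ c.2.val = 0) ↔ c = 0 := by
    rw [Prod.ext_iff, Fin.ext_iff, Fin.ext_iff]
    rfl
  simp only [X_apply, one_apply, h]

theorem X_eq_zero {a b : ℕ} (h : 4 < a ∨ 4 < b) : X F a b = 0 := by
  ext c
  rw [X_apply, zero_apply, if_neg]
  have := c.1.isLt
  have := c.2.isLt
  omega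

theorem d₁_X_zero (b : ℕ) : d₁ (X F 0 b) = 0 := by
  ext c
  rw [d₁_apply, X_apply, zero_apply]
  obtain ⟨c1, c2⟩ := c
  fin_cases c1 <;> simp

theorem d₂_X_zero (a : ℕ) : d₂ (X F a 0) = 0 := by
  ext c
  rw [d₂_apply, X_apply, zero_apply]
  obtain ⟨c1, c2⟩ := c
  fin_cases c2 <;> simp

theorem d₁_X_succ {a : ℕ} (h : a < 4) (b : ℕ) : d₁ (X F (a + 1) b) = X F a b := by
  ext c
  rw [d₁_apply, X_apply, X_apply]
  obtain ⟨c1, c2⟩ := c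
  interval_cases a <;> fin_cases c1 <;> simp

theorem d₂_X_succ (a : ℕ) {b : ℕ} (h : b < 4) : d₂ (X F a (b + 1)) = X F a b := by
  ext c
  rw [d₂_apply, X_apply, X_apply]
  obtain ⟨c1, c2⟩ := c
  interval_cases b <;> fin_cases c2 <;> simp

/-- The guard `4 < a` matters at `a = 5`, where the monomial is `0` but lowering the exponent would
give a nonzero one. -/
theorem d₁_X (a b : ℕ) : d₁ (X F a b) = if a = 0 ∨ 4 < a then 0 else X F (a - 1) b := by
  split_ifs with h
  · rcases h with rfl | h
    · exact d₁_X_zero b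
    · rw [X_eq_zero (Or.inl h), map_zero]
  · obtain ⟨a, rfl⟩ := Nat.exists_eq_succ_of_ne_zero (n := a) (by omega)
    exact d₁_X_succ (by omega) b

theorem d₂_X (a b : ℕ) : d₂ (X F a b) = if b = 0 ∨ 4 < b then 0 else X F a (b - 1) := by
  split_ifs with h
  · rcases h with rfl | h
    · exact d₂_X_zero a
    · rw [X_eq_zero (Or.inr h), map_zero]
  · obtain ⟨b, rfl⟩ := Nat.exists_eq_succ_of_ne_zero (n := b) (by omega)
    exact d₂_X_succ a (by omega)

/-- Reading overflowing monomials as `0` makes the product formula hold without bounds on the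
exponents. -/
theorem X_mul_X (a b c d : ℕ) :
    X F a b * X F c d = ((a + c).choose a * (b + d).choose b : ℕ) • X F (a + c) (b + d) := by
  by_cases h : a < 5 ∧ b < 5
  swap
  · rw [X_eq_zero (a := a) (by omega), X_eq_zero (a := a + c) (by omega), zero_mul, smul_zero]
  ext ⟨p, q⟩
  rw [mul_apply, Finset.sum_eq_single ((⟨a, h.1⟩ : Fin 5), (⟨b, h.2⟩ : Fin 5))]
  · have hn : ∀ n : ℕ, (n • X F (a + c) (b + d)) (p, q) = n * X F (a + c) (b + d) (p, q) := by
      intro n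
      rw [← Nat.cast_smul_eq_nsmul F, smul_apply]
    rw [hn]
    simp only [X_apply, Prod.mk_sub_mk, and_self, if_true, mul_one, binom]
    have hp := p.isLt
    have hq := q.isLt
    by_cases hap : a ≤ p.val
    · by_cases hbq : b ≤ q.val
      · have h1 : (p - ⟨a, h.1⟩ : Fin 5).val = p.val - a := Fin.sub_val_of_le hap
        have h2 : (q - ⟨b, h.2⟩ : Fin 5).val = q.val - b := Fin.sub_val_of_le hbq
        rw [h1, h2]
        by_cases hpq : p.val = a + c ∧ q.val = b + d
        · rw [if_pos (by omega), if_pos hpq, hpq.1, hpq.2]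
        · rw [if_neg (by omega), if_neg hpq, mul_zero, mul_zero]
      · rw [Nat.choose_eq_zero_of_lt (n := q.val) (by omega), if_neg (c := p.val = a + c ∧ _)
          (by omega)]
        simp
    · rw [Nat.choose_eq_zero_of_lt (n := p.val) (by omega), if_neg (c := p.val = a + c ∧ _)
          (by omega)]
      simp
  · rintro ⟨r, s⟩ - hrs
    rw [X_apply, if_neg, mul_zero, zero_mul]
    simpa [Prod.ext_iff, Fin.ext_iff] using hrs
  · simp

/-- The Euler operator `x₁ ∂₁` multiplies `x₁^(a) x₂^(b)` by `a`. -/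
theorem X_mul_d₁_X (a b : ℕ) : X F 1 0 * d₁ (X F a b) = (a : F) • X F a b := by
  by_cases h : a < 5
  · cases a with
    | zero => simp [d₁_X_zero]
    | succ a =>
      rw [d₁_X_succ (by omega), X_mul_X, Nat.cast_smul_eq_nsmul F]
      simp [add_comm 1 a]
  · simp [X_eq_zero (F := F) (a := a) (b := b) (by omega)]

theorem X_mul_d₂_X (a b : ℕ) : X F 0 1 * d₂ (X F a b) = (b : F) • X F a b := by
  by_cases h : b < 5
  · cases b with
    | zero => simp [d₂_X_zero]
    | succ b =>
      rw [d₂_X_succ _ (by omega), X_mul_X, Nat.cast_smul_eq_nsmul F]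
      simp [add_comm 1 b]
  · simp [X_eq_zero (F := F) (a := a) (b := b) (by omega)]

theorem eq_sum_X (f : DivPow F) :
    f = ∑ c : Fin 5 × Fin 5, f c • X F c.1.val c.2.val := by
  have happ : ∀ (s : Finset (Fin 5 × Fin 5)) (g : Fin 5 × Fin 5 → DivPow F) (d),
      (∑ c ∈ s, g c) d = ∑ c ∈ s, g c d := fun s g d => Finset.sum_apply d s g
  ext d
  rw [happ, Finset.sum_eq_single d]
  · simp [smul_apply, X_apply]
  · intro c _ hc
    rw [smul_apply, X_apply, if_neg, mul_zero]
    intro h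
    exact hc (Prod.ext (Fin.ext h.1.symm) (Fin.ext h.2.symm))
  · simp

end DivPow

/-! ### The monomial basis of `ℳ` and its brackets -/

namespace Melikian

open DivPow WittAlg

variable {F : Type*} [CommRing F]

/-- The element `f`, `f ∂₁`, `f ∂₂`, `(f ∂₁)~`, `(f ∂₂)~` of `ℳ(1,1)`, for
`u = 0, 1, 2, 3, 4`. -/
def embFun (u : Fin 5) (f : DivPow F) : Melikian F :=
  ((if u = 0 then f else 0), (if u = 1 then f else 0, if u = 2 then f else 0),
    (if u = 3 then f else 0, if u = 4 then f else 0))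

theorem embFun_fn (u : Fin 5) (f : DivPow F) : (embFun u f).fn = if u = 0 then f else 0 := rfl
theorem embFun_vec (u : Fin 5) (f : DivPow F) :
    (embFun u f).vec = (if u = 1 then f else 0, if u = 2 then f else 0) := rfl
theorem embFun_til (u : Fin 5) (f : DivPow F) :
    (embFun u f).til = (if u = 3 then f else 0, if u = 4 then f else 0) := rfl

/-- The embeddings `f ↦ f`, `f ↦ f ∂₁`, `f ↦ f ∂₂`, `f ↦ (f ∂₁)~`, `f ↦ (f ∂₂)~` of
`𝒪(2; (1,1))` into `ℳ(1,1)`, for `u = 0, 1, 2, 3, 4`. -/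
def emb (u : Fin 5) : DivPow F →ₗ[F] Melikian F where
  toFun := embFun u
  map_add' f g := by
    apply ext_comp <;> simp only [add_fn, add_vec, add_til, embFun_fn, embFun_vec, embFun_til] <;>
      fin_cases u <;> simp
  map_smul' r f := by
    apply ext_comp <;> simp only [smul_fn, smul_vec, smul_til, embFun_fn, embFun_vec, embFun_til,
      RingHom.id_apply] <;> fin_cases u <;> simp

theorem emb_fn (u : Fin 5) (f : DivPow F) : (emb u f).fn = if u = 0 then f else 0 := rfl
theorem emb_vec (u : Fin 5) (f : DivPow F) :
    (emb u f).vec = (if u = 1 then f else 0, if u = 2 then f else 0) := rfl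
theorem emb_til (u : Fin 5) (f : DivPow F) :
    (emb u f).til = (if u = 3 then f else 0, if u = 4 then f else 0) := rfl

/-- The component of `x` along `emb u`. -/
def comp (u : Fin 5) : Melikian F →ₗ[F] DivPow F where
  toFun x := ![x.fn, x.vec.1, x.vec.2, x.til.1, x.til.2] u
  map_add' x y := by fin_cases u <;> rfl
  map_smul' r x := by fin_cases u <;> rfl

theorem comp_emb (u v : Fin 5) (f : DivPow F) : comp u (emb v f) = if v = u then f else 0 := by
  fin_cases u <;> rfl

theorem sum_emb_comp (x : Melikian F) : ∑ u : Fin 5, emb u (comp u x) = x := by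
  simp only [Fin.sum_univ_five]
  apply ext_comp <;> simp [add_fn, add_vec, add_til, emb_fn, emb_vec, emb_til, comp]

/-- The basis element `x₁^(a) x₂^(b)` of the copy `emb u` of `𝒪(2; (1,1))`, read as `0` if `a`
or `b` exceeds `4`. -/
def e (F : Type*) [CommRing F] (u : Fin 5) (a b : ℕ) : Melikian F := emb u (X F a b)

theorem sum_smul_e (x : Melikian F) :
    ∑ u : Fin 5, ∑ c : Fin 5 × Fin 5, comp u x c • e F u c.1.val c.2.val = x := by
  conv_rhs => rw [← sum_emb_comp x]
  refine Finset.sum_congr rfl fun u _ => ?_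
  conv_rhs => rw [eq_sum_X (comp u x)]
  simp [e]

section Linear

variable {V : Type*} [AddCommGroup V] [Module F V]

theorem linearMap_ext {f g : Melikian F →ₗ[F] V}
    (h : ∀ u a b, a < 5 → b < 5 → f (e F u a b) = g (e F u a b)) : f = g := by
  ext x
  rw [← sum_smul_e x]
  simp only [map_sum, map_smul]
  exact Finset.sum_congr rfl fun u _ => Finset.sum_congr rfl fun c _ => by
    rw [h u _ _ c.1.isLt c.2.isLt]

/-- The linear map with prescribed values on the basis elements `e F u a b`. -/
def ofValues (v : Fin 5 → ℕ → ℕ → V) : Melikian F →ₗ[F] V where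
  toFun x := ∑ u : Fin 5, ∑ c : Fin 5 × Fin 5, comp u x c • v u c.1.val c.2.val
  map_add' x y := by
    simp only [map_add, DivPow.add_apply, add_smul, Finset.sum_add_distrib]
  map_smul' r x := by
    simp only [map_smul, DivPow.smul_apply, mul_smul, Finset.smul_sum, RingHom.id_apply]

theorem ofValues_e (v : Fin 5 → ℕ → ℕ → V) (u : Fin 5) {a b : ℕ} (ha : a < 5) (hb : b < 5) :
    ofValues v (e F u a b) = v u a b := by
  change ∑ w : Fin 5, ∑ c : Fin 5 × Fin 5, comp w (emb u (X F a b)) c • v w c.1.val c.2.val = _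
  rw [Finset.sum_eq_single u, Finset.sum_eq_single ((⟨a, ha⟩ : Fin 5), (⟨b, hb⟩ : Fin 5))]
  · simp [comp_emb, X_apply]
  · rintro ⟨p, q⟩ - h
    rw [comp_emb, if_pos rfl, X_apply, if_neg, zero_smul]
    simpa [Prod.ext_iff, Fin.ext_iff] using h
  · simp
  · intro w _ h
    simp [comp_emb, h.symm, DivPow.zero_apply]
  · simp

end Linear

/-- The multiplicity of `∂₁(p) f` in the bracket of `p ∂₁` with the copy `emb u` of `f`. -/
def k₁ : Fin 5 → ℤ := ![-2, -1, 0, 1, 2]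

/-- The multiplicity of `∂₂(p) f` in the bracket of `p ∂₂` with the copy `emb u` of `f`. -/
def k₂ : Fin 5 → ℤ := ![-2, 0, -1, 2, 1]

/-- When `∂₂ p = 0`, the field `p ∂₁` preserves each of the five copies of `𝒪`; in general `[p ∂₁, f
∂₂]` also has the component `-f ∂₂(p) ∂₁`. -/
theorem lie_emb_one {p : DivPow F} (hp : d₂ p = 0) (u : Fin 5) (f : DivPow F) :
    ⁅emb 1 p, emb u f⁆ = emb u (p * d₁ f + (k₁ u : DivPow F) * (d₁ p * f)) := by
  fin_cases u <;> apply ext_comp <;>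
    simp only [lie_fn, lie_vec, lie_til, emb_fn, emb_vec, emb_til] <;>
    simp [app, div, brak, ham, k₁, hp] <;> ring

theorem lie_emb_two {p : DivPow F} (hp : d₁ p = 0) (u : Fin 5) (f : DivPow F) :
    ⁅emb 2 p, emb u f⁆ = emb u (p * d₂ f + (k₂ u : DivPow F) * (d₂ p * f)) := by
  fin_cases u <;> apply ext_comp <;>
    simp only [lie_fn, lie_vec, lie_til, emb_fn, emb_vec, emb_til] <;>
    simp [app, div, brak, ham, k₂, hp] <;> ring

theorem lie_emb_zero_three (f g : DivPow F) : ⁅emb 0 f, emb 3 g⁆ = emb 1 (f * g) := by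
  apply ext_comp <;>
    simp [lie_fn, lie_vec, lie_til, emb_fn, emb_vec, emb_til, app, div, brak, ham]

theorem lie_emb_zero_four (f g : DivPow F) : ⁅emb 0 f, emb 4 g⁆ = emb 2 (f * g) := by
  apply ext_comp <;>
    simp [lie_fn, lie_vec, lie_til, emb_fn, emb_vec, emb_til, app, div, brak, ham]

theorem lie_emb_zero_zero (f g : DivPow F) : ⁅emb 0 f, emb 0 g⁆ =
    emb 3 (2 * (g * d₂ f - f * d₂ g)) + emb 4 (2 * (f * d₁ g - g * d₁ f)) := by
  apply ext_comp <;>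
    simp [lie_fn, lie_vec, lie_til, emb_fn, emb_vec, emb_til, app, div, brak, ham, add_fn,
      add_vec, add_til]
  ring

/-- The weight of `e F u a b` with respect to `x₁ ∂₁`. -/
def w₁ (u : Fin 5) (a : ℕ) : ℤ := a + k₁ u

/-- The weight of `e F u a b` with respect to `x₂ ∂₂`. -/
def w₂ (u : Fin 5) (b : ℕ) : ℤ := b + k₂ u

theorem intCast_mul_eq_smul (n : ℤ) (f : DivPow F) : (n : DivPow F) * f = (n : F) • f := by
  rw [Int.cast_smul_eq_zsmul, zsmul_eq_mul]

theorem lie_t₁_e (u : Fin 5) (a b : ℕ) :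
    ⁅e F 1 1 0, e F u a b⁆ = (w₁ u a : F) • e F u a b := by
  rw [e, e, lie_emb_one (d₂_X_zero 1), X_mul_d₁_X, intCast_mul_eq_smul, ← zero_add 1,
    d₁_X_succ (by norm_num), X_zero_zero, one_mul, ← add_smul, map_smul, w₁]
  push_cast
  rfl

theorem lie_t₂_e (u : Fin 5) (a b : ℕ) :
    ⁅e F 2 0 1, e F u a b⁆ = (w₂ u b : F) • e F u a b := by
  rw [e, e, lie_emb_two (d₁_X_zero 1), X_mul_d₂_X, intCast_mul_eq_smul, ← zero_add 1,
    d₂_X_succ _ (by norm_num), X_zero_zero, one_mul, ← add_smul, map_smul, w₂]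
  push_cast
  rfl

theorem lie_t₁_t₂ : ⁅e F 1 1 0, e F 2 0 1⁆ = 0 := by
  rw [lie_t₁_e]
  simp [w₁, k₁]

theorem lie_d₁_emb (u : Fin 5) (f : DivPow F) : ⁅e F 1 0 0, emb u f⁆ = emb u (d₁ f) := by
  rw [e, lie_emb_one (d₂_X_zero 0), d₁_X_zero, X_zero_zero]
  simp

theorem lie_d₂_emb (u : Fin 5) (f : DivPow F) : ⁅e F 2 0 0, emb u f⁆ = emb u (d₂ f) := by
  rw [e, lie_emb_two (d₁_X_zero 0), d₂_X_zero, X_zero_zero]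
  simp

theorem lie_d₁_e_zero (u : Fin 5) (b : ℕ) : ⁅e F 1 0 0, e F u 0 b⁆ = 0 := by
  rw [e.eq_def F u, lie_d₁_emb, d₁_X_zero, map_zero]

theorem lie_d₂_e_zero (u : Fin 5) (a : ℕ) : ⁅e F 2 0 0, e F u a 0⁆ = 0 := by
  rw [e.eq_def F u, lie_d₂_emb, d₂_X_zero, map_zero]

theorem lie_d₁_e_succ (u : Fin 5) {a : ℕ} (ha : a < 4) (b : ℕ) :
    ⁅e F 1 0 0, e F u (a + 1) b⁆ = e F u a b := by
  rw [e.eq_def F u, lie_d₁_emb, d₁_X_succ ha, e]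

theorem lie_d₂_e_succ (u : Fin 5) (a : ℕ) {b : ℕ} (hb : b < 4) :
    ⁅e F 2 0 0, e F u a (b + 1)⁆ = e F u a b := by
  rw [e.eq_def F u, lie_d₂_emb, d₂_X_succ a hb, e]

end Melikian

/-! ### Cocycles with trivial coefficients and their radical -/

/-- A bilinear map which is alternating and satisfies the cocycle identity for trivial
coefficients. -/
structure IsTrivialCocycle {R L V : Type*} [CommRing R] [LieRing L] [LieAlgebra R L]
    [AddCommGroup V] [Module R V] (ω : L →ₗ[R] L →ₗ[R] V) : Prop where
  alt : ∀ x, ω x x = 0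
  leibniz : ∀ x y z, ω x ⁅y, z⁆ = ω ⁅x, y⁆ z + ω y ⁅x, z⁆

namespace IsTrivialCocycle

variable {R L V : Type*} [CommRing R] [LieRing L] [LieAlgebra R L] [AddCommGroup V] [Module R V]
  {ω : L →ₗ[R] L →ₗ[R] V}

theorem skew (h : IsTrivialCocycle ω) (x y : L) : ω x y = -ω y x := by
  have := h.alt (x + y)
  simp only [map_add, LinearMap.add_apply, h.alt, zero_add, add_zero] at this
  exact eq_neg_of_add_eq_zero_right this

/-- The radical of a cocycle with trivial coefficients is closed under the bracket. -/
theorem lie_eq_zero (h : IsTrivialCocycle ω) {x y : L} (hx : ω x = 0) (hy : ω y = 0) :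
    ω ⁅x, y⁆ = 0 := by
  ext z
  have := h.leibniz x y z
  rw [hx, hy] at this
  simpa using this.symm

/-- A cocycle is invariant under the elements of its radical. -/
theorem invariant (h : IsTrivialCocycle ω) {x : L} (hx : ω x = 0) (y z : L) :
    ω ⁅x, y⁆ z = -ω y ⁅x, z⁆ := by
  have := h.leibniz x y z
  rw [hx] at this
  exact eq_neg_of_add_eq_zero_left (by simpa using this.symm)

theorem sub_coboundary (h : IsTrivialCocycle ω) (f : L →ₗ[R] V)
    {η : L →ₗ[R] L →ₗ[R] V} (hη : ∀ x y, η x y = ω x y - f ⁅x, y⁆) : IsTrivialCocycle η where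
  alt x := by rw [hη, h.alt, lie_self, map_zero, sub_zero]
  leibniz x y z := by
    rw [hη, hη, hη, h.leibniz, leibniz_lie, map_add]
    abel

end IsTrivialCocycle

/-! ### Normalizing a cocycle -/

namespace Melikian

open DivPow WittAlg

variable {F : Type*} [Field F] [CharP F 5] {V : Type*} [AddCommGroup V] [Module F V]

theorem intCast_eq_zero_iff_dvd (n : ℤ) : (n : F) = 0 ↔ 5 ∣ n :=
  CharP.intCast_eq_zero_iff F 5 n

/-- A cocycle on `ℳ(1,1)` with trivial coefficients which vanishes on the pairs consisting of
`x₁ ∂₁` or `x₂ ∂₂` and a vector of nonzero weight for it, and on enough of the pairs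
consisting of `∂₁` or `∂₂` and a vector which it brings to weight zero. -/
structure IsNormalized (ω : Melikian F →ₗ[F] Melikian F →ₗ[F] V) : Prop
    extends IsTrivialCocycle ω where
  torus₁ : ∀ u a b, a < 5 → b < 5 → ¬ 5 ∣ w₁ u a → ω (e F 1 1 0) (e F u a b) = 0
  torus₂ : ∀ u a b, a < 5 → b < 5 → ¬ 5 ∣ w₂ u b → ω (e F 2 0 1) (e F u a b) = 0
  left : ∀ u a b, a < 4 → b < 5 → 5 ∣ w₁ u a → 5 ∣ w₂ u b → ω (e F 1 0 0) (e F u (a + 1) b) = 0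
  right : ∀ u b, b < 4 → 5 ∣ w₁ u 4 → 5 ∣ w₂ u b → ω (e F 2 0 0) (e F u 4 (b + 1)) = 0

/-- Each basis vector is a multiple of a bracket with `x₁ ∂₁`, `x₂ ∂₂`, `∂₁` or `∂₂`, and `f` is
defined there by the value of `ω` on that pair. The torus serves nonzero weights, the partial
derivatives weight zero. -/
theorem exists_normalized {ω : Melikian F →ₗ[F] Melikian F →ₗ[F] V} (h : IsTrivialCocycle ω) :
    ∃ f : Melikian F →ₗ[F] V, ∃ η, IsNormalized η ∧ ∀ x y, η x y = ω x y - f ⁅x, y⁆ := by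
  classical
  let f : Melikian F →ₗ[F] V := ofValues fun u a b =>
    if 5 ∣ w₁ u a then
      if 5 ∣ w₂ u b then
        -- At `a = b = 4` this would read a vanishing monomial, but no top monomial has weight zero
        -- for both torus elements.
        if a < 4 then ω (e F 1 0 0) (e F u (a + 1) b) else ω (e F 2 0 0) (e F u a (b + 1))
      else (w₂ u b : F)⁻¹ • ω (e F 2 0 1) (e F u a b)
    else (w₁ u a : F)⁻¹ • ω (e F 1 1 0) (e F u a b)
  let η : Melikian F →ₗ[F] Melikian F →ₗ[F] V :=
    ω - (LieModule.toEnd F (Melikian F) (Melikian F) : Melikian F →ₗ[F] _).compr₂ f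
  have hη : ∀ x y, η x y = ω x y - f ⁅x, y⁆ := fun x y => rfl
  refine ⟨f, η, ⟨h.sub_coboundary f hη, ?_, ?_, ?_, ?_⟩, hη⟩
  · intro u a b ha hb h1
    rw [hη, lie_t₁_e, map_smul, ofValues_e _ u ha hb, if_neg h1,
      smul_inv_smul₀ ((intCast_eq_zero_iff_dvd _).not.mpr h1), sub_self]
  · intro u a b ha hb h2
    -- The torus is commutative, so the values of `ω` against its two generators are proportional,
    -- and a choice of `f` made with the first also suits the second.
    have comm : (w₁ u a : F) • ω (e F 2 0 1) (e F u a b) =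
        (w₂ u b : F) • ω (e F 1 1 0) (e F u a b) := by
      have := h.leibniz (e F 1 1 0) (e F 2 0 1) (e F u a b)
      rw [lie_t₁_t₂, lie_t₁_e, lie_t₂_e] at this
      simpa using this.symm
    rw [hη, lie_t₂_e, map_smul, ofValues_e _ u ha hb]
    by_cases h1 : 5 ∣ w₁ u a
    · rw [if_pos h1, if_neg h2, smul_inv_smul₀ ((intCast_eq_zero_iff_dvd _).not.mpr h2), sub_self]
    · rw [if_neg h1, smul_comm, ← comm, inv_smul_smul₀ ((intCast_eq_zero_iff_dvd _).not.mpr h1),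
        sub_self]
  · intro u a b ha hb h1 h2
    rw [hη, lie_d₁_e_succ u ha, ofValues_e _ u (by omega) hb, if_pos h1, if_pos h2, if_pos ha,
      sub_self]
  · intro u b hb h1 h2
    rw [hη, lie_d₂_e_succ u 4 hb, ofValues_e _ u (by omega) (by omega), if_pos h1, if_pos h2,
      if_neg (by omega), sub_self]

namespace IsNormalized

variable {ω : Melikian F →ₗ[F] Melikian F →ₗ[F] V}

theorem t₁_lie (h : IsNormalized ω) (x : Melikian F) :
    ω (e F 1 1 0) ⁅e F 1 1 0, x⁆ = 0 := by
  rw [← sum_smul_e x]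
  simp only [lie_sum, map_sum, lie_smul, map_smul, lie_t₁_e]
  refine Finset.sum_eq_zero fun u _ => Finset.sum_eq_zero fun c _ => ?_
  by_cases hw : 5 ∣ w₁ u c.1.val
  · simp [(intCast_eq_zero_iff_dvd (F := F) _).mpr hw]
  · simp [h.torus₁ u _ _ c.1.isLt c.2.isLt hw]

theorem t₂_lie (h : IsNormalized ω) (x : Melikian F) :
    ω (e F 2 0 1) ⁅e F 2 0 1, x⁆ = 0 := by
  rw [← sum_smul_e x]
  simp only [lie_sum, map_sum, lie_smul, map_smul, lie_t₂_e]
  refine Finset.sum_eq_zero fun u _ => Finset.sum_eq_zero fun c _ => ?_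
  by_cases hw : 5 ∣ w₂ u c.2.val
  · simp [(intCast_eq_zero_iff_dvd (F := F) _).mpr hw]
  · simp [h.torus₂ u _ _ c.1.isLt c.2.isLt hw]

/-- With `t = x₁ ∂₁`, `s` the total weight and `x`, `y` the two vectors, the cocycle identity gives
`s ω(x, y) = ω(t, [x, y])`. Since `s [x, y] = [t, [x, y]]`, `t₁_lie` kills the right side after
multiplication by `s`. -/
theorem eq_zero_of_w₁ (h : IsNormalized ω) {u v : Fin 5} {a c : ℕ} (b d : ℕ)
    (hw : ¬ 5 ∣ w₁ u a + w₁ v c) : ω (e F u a b) (e F v c d) = 0 := by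
  set s : F := (w₁ u a : F) + (w₁ v c : F)
  have hs : s ≠ 0 := by
    have := (intCast_eq_zero_iff_dvd (F := F) _).not.mpr hw
    rwa [Int.cast_add] at this
  have h1 : ω (e F 1 1 0) ⁅e F u a b, e F v c d⁆ = s • ω (e F u a b) (e F v c d) := by
    rw [h.leibniz, lie_t₁_e, lie_t₁_e, map_smul, map_smul, LinearMap.smul_apply, ← add_smul]
  have h2 : ⁅e F 1 1 0, ⁅e F u a b, e F v c d⁆⁆ = s • ⁅e F u a b, e F v c d⁆ := by
    rw [leibniz_lie, lie_t₁_e, lie_t₁_e, smul_lie, lie_smul, ← add_smul]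
  have h3 := h.t₁_lie ⁅e F u a b, e F v c d⁆
  rw [h2, map_smul, smul_eq_zero_iff_right hs, h1, smul_eq_zero_iff_right hs] at h3
  exact h3

theorem eq_zero_of_w₂ (h : IsNormalized ω) {u v : Fin 5} (a c : ℕ) {b d : ℕ}
    (hw : ¬ 5 ∣ w₂ u b + w₂ v d) : ω (e F u a b) (e F v c d) = 0 := by
  set s : F := (w₂ u b : F) + (w₂ v d : F)
  have hs : s ≠ 0 := by
    have := (intCast_eq_zero_iff_dvd (F := F) _).not.mpr hw
    rwa [Int.cast_add] at this
  have h1 : ω (e F 2 0 1) ⁅e F u a b, e F v c d⁆ = s • ω (e F u a b) (e F v c d) := by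
    rw [h.leibniz, lie_t₂_e, lie_t₂_e, map_smul, map_smul, LinearMap.smul_apply, ← add_smul]
  have h2 : ⁅e F 2 0 1, ⁅e F u a b, e F v c d⁆⁆ = s • ⁅e F u a b, e F v c d⁆ := by
    rw [leibniz_lie, lie_t₂_e, lie_t₂_e, smul_lie, lie_smul, ← add_smul]
  have h3 := h.t₂_lie ⁅e F u a b, e F v c d⁆
  rw [h2, map_smul, smul_eq_zero_iff_right hs, h1, smul_eq_zero_iff_right hs] at h3
  exact h3

/-! ### The partial derivatives lie in the radical -/

theorem d₁_d₂_swap (h : IsNormalized ω) (x : Melikian F) :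
    ω (e F 1 0 0) ⁅e F 2 0 0, x⁆ = ω (e F 2 0 0) ⁅e F 1 0 0, x⁆ := by
  rw [h.leibniz, lie_d₁_e_zero, map_zero, LinearMap.zero_apply, zero_add]

/-- Of the partners allowed by weight, those with `a ≠ 0` are covered by the normalization. For `a =
0` the point is that `b = 4` does not occur, so the partner is a bracket with `∂₂`. -/
theorem d₁_weight : ∀ u a b : Fin 5, 5 ∣ w₁ 1 0 + w₁ u a.val → 5 ∣ w₂ 1 0 + w₂ u b.val →
    (a ≠ 0 ∧ 5 ∣ w₁ u (a.val - 1) ∧ 5 ∣ w₂ u b.val) ∨ (a = 0 ∧ b.val < 4) := by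
  decide

theorem d₂_weight : ∀ u a b : Fin 5, 5 ∣ w₁ 2 0 + w₁ u a.val → 5 ∣ w₂ 2 0 + w₂ u b.val →
    a.val < 4 ∨ (a = 4 ∧ b ≠ 0 ∧ 5 ∣ w₁ u 4 ∧ 5 ∣ w₂ u (b.val - 1)) := by
  decide

theorem d₁_mem_radical (h : IsNormalized ω) : ω (e F 1 0 0) = 0 := by
  refine linearMap_ext fun u a b ha hb => ?_
  rw [LinearMap.zero_apply]
  by_cases h1 : 5 ∣ w₁ 1 0 + w₁ u a
  swap
  · exact h.eq_zero_of_w₁ 0 b h1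
  by_cases h2 : 5 ∣ w₂ 1 0 + w₂ u b
  swap
  · exact h.eq_zero_of_w₂ 0 a h2
  rcases d₁_weight u ⟨a, ha⟩ ⟨b, hb⟩ h1 h2 with ⟨h0, h3, h4⟩ | ⟨h0, h3⟩
  · obtain ⟨a, rfl⟩ := Nat.exists_eq_succ_of_ne_zero (n := a) (fun h => h0 (Fin.ext h))
    exact h.left u a b (by omega) hb h3 h4
  · obtain rfl : a = 0 := congrArg Fin.val h0
    -- Write the partner as `[∂₂, y]`; exchanging the derivatives leaves `[∂₁, y]`, which is `0`
    -- because `y` does not involve `x₁`.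
    rw [← lie_d₂_e_succ u 0 h3, h.d₁_d₂_swap, lie_d₁_e_zero, map_zero]

theorem d₂_mem_radical (h : IsNormalized ω) : ω (e F 2 0 0) = 0 := by
  refine linearMap_ext fun u a b ha hb => ?_
  rw [LinearMap.zero_apply]
  by_cases h1 : 5 ∣ w₁ 2 0 + w₁ u a
  swap
  · exact h.eq_zero_of_w₁ 0 b h1
  by_cases h2 : 5 ∣ w₂ 2 0 + w₂ u b
  swap
  · exact h.eq_zero_of_w₂ 0 a h2
  rcases d₂_weight u ⟨a, ha⟩ ⟨b, hb⟩ h1 h2 with h0 | ⟨h5, h0, h3, h4⟩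
  · rw [← lie_d₁_e_succ u h0, ← h.d₁_d₂_swap, h.d₁_mem_radical, LinearMap.zero_apply]
  · obtain rfl : a = 4 := congrArg Fin.val h5
    obtain ⟨b, rfl⟩ := Nat.exists_eq_succ_of_ne_zero (n := b) (fun h => h0 (Fin.ext h))
    exact h.right u b (by omega) h3 h4

/-! ### Consequences of invariance under `∂₁` and `∂₂` -/

theorem shift₁ (h : IsNormalized ω) (u v : Fin 5) {a c : ℕ} (b d : ℕ) (ha : a < 4) (hc : c < 4) :
    ω (e F u a b) (e F v (c + 1) d) = -ω (e F u (a + 1) b) (e F v c d) := by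
  rw [← lie_d₁_e_succ u ha, h.invariant h.d₁_mem_radical, lie_d₁_e_succ v hc]

theorem shift₂ (h : IsNormalized ω) (u v : Fin 5) (a c : ℕ) {b d : ℕ} (hb : b < 4) (hd : d < 4) :
    ω (e F u a b) (e F v c (d + 1)) = -ω (e F u a (b + 1)) (e F v c d) := by
  rw [← lie_d₂_e_succ u a hb, h.invariant h.d₂_mem_radical, lie_d₂_e_succ v c hd]

/-- Move all of the exponent of `x₁` to the left argument. As it stays below 4, that argument is
still in the image of `∂₁`, while `∂₁` kills the right one. -/
theorem eq_zero_of_add_lt₁ (h : IsNormalized ω) (u v : Fin 5) {a c : ℕ} (b d : ℕ)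
    (hac : a + c < 4) : ω (e F u a b) (e F v c d) = 0 := by
  induction c generalizing a with
  | zero =>
    rw [← lie_d₁_e_succ u (by omega : a < 4), h.invariant h.d₁_mem_radical, lie_d₁_e_zero, map_zero,
      neg_zero]
  | succ c ih => rw [h.shift₁ u v b d (by omega) (by omega), ih (by omega), neg_zero]

theorem eq_zero_of_add_lt₂ (h : IsNormalized ω) (u v : Fin 5) (a c : ℕ) {b d : ℕ}
    (hbd : b + d < 4) : ω (e F u a b) (e F v c d) = 0 := by
  induction d generalizing b with
  | zero =>
    rw [← lie_d₂_e_succ u a (by omega : b < 4), h.invariant h.d₂_mem_radical, lie_d₂_e_zero,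
      map_zero, neg_zero]
  | succ d ih => rw [h.shift₂ u v a c (by omega) (by omega), ih (by omega), neg_zero]

theorem eq_of_add_eq₁ (h : IsNormalized ω) (u v : Fin 5) {a c : ℕ} (b d : ℕ) (hac : a + c = 4) :
    ω (e F u a b) (e F v c d) = (-1 : ℤ) ^ c • ω (e F u 4 b) (e F v 0 d) := by
  induction c generalizing a with
  | zero => simp_all
  | succ c ih => rw [h.shift₁ u v b d (by omega) (by omega), ih (by omega), pow_succ]; simp

theorem eq_of_add_eq₂ (h : IsNormalized ω) (u v : Fin 5) (a c : ℕ) {b d : ℕ} (hbd : b + d = 4) :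
    ω (e F u a b) (e F v c d) = (-1 : ℤ) ^ d • ω (e F u a 4) (e F v c 0) := by
  induction d generalizing b with
  | zero => simp_all
  | succ d ih => rw [h.shift₂ u v a c (by omega) (by omega), ih (by omega), pow_succ]; simp

theorem eq_of_add_eq (h : IsNormalized ω) (u v : Fin 5) {a b c d : ℕ} (hac : a + c = 4)
    (hbd : b + d = 4) : ω (e F u a b) (e F v c d)
      = (-1 : ℤ) ^ c • (-1 : ℤ) ^ d • ω (e F u 4 4) (e F v 0 0) := by
  rw [h.eq_of_add_eq₁ u v b d hac, h.eq_of_add_eq₂ u v 4 0 hbd]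

theorem eq_zero_of_add_eq (h : IsNormalized ω) {u v : Fin 5} {a b c d : ℕ} (hac : a + c = 4)
    (hbd : b + d = 4) (huv : (u = 0 ∧ v = 0) ∨ u = 1 ∨ u = 2 ∨ v = 1 ∨ v = 2) :
    ω (e F u a b) (e F v c d) = 0 := by
  rcases huv with ⟨rfl, rfl⟩ | rfl | rfl | rfl | rfl
  -- All values with exponent total `(4, 4)` agree up to sign, and the one at the middle pair
  -- vanishes because `ω` is alternating.
  · have h2 := h.eq_of_add_eq 0 0 (a := 2) (b := 2) (c := 2) (d := 2) rfl rfl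
    rw [h.alt] at h2
    rw [h.eq_of_add_eq 0 0 hac hbd, show ω (e F 0 4 4) (e F 0 0 0) = 0 by simpa using h2.symm]
    simp
  -- In the remaining cases all exponents are moved off the copy of `𝒪 ∂₁` or `𝒪 ∂₂`, leaving `∂₁`
  -- or `∂₂` itself.
  · rw [h.skew, h.eq_of_add_eq v 1 (by omega) (by omega), h.skew, h.d₁_mem_radical]
    simp
  · rw [h.skew, h.eq_of_add_eq v 2 (by omega) (by omega), h.skew, h.d₂_mem_radical]
    simp
  · rw [h.eq_of_add_eq u 1 hac hbd, h.skew, h.d₁_mem_radical]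
    simp
  · rw [h.eq_of_add_eq u 2 hac hbd, h.skew, h.d₂_mem_radical]
    simp

/-! ### From low monomials to the whole algebra -/

/-- The basis elements which lie in the radical for reasons of weight. -/
def IsLow (u : Fin 5) (a b : ℕ) : Prop :=
  ∀ v c d : Fin 5, ¬ 5 ∣ w₁ u a + w₁ v c.val ∨ ¬ 5 ∣ w₂ u b + w₂ v d.val ∨ a + c.val < 4 ∨
    b + d.val < 4 ∨ (a + c.val = 4 ∧ b + d.val = 4 ∧
      ((u = 0 ∧ v = 0) ∨ u = 1 ∨ u = 2 ∨ v = 1 ∨ v = 2))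

instance (u : Fin 5) (a b : ℕ) : Decidable (IsLow u a b) := by
  unfold IsLow; infer_instance

theorem mem_radical_of_isLow (h : IsNormalized ω) {u : Fin 5} {a b : ℕ} (hl : IsLow u a b) :
    ω (e F u a b) = 0 := by
  refine linearMap_ext fun v c d hc hd => ?_
  rw [LinearMap.zero_apply]
  rcases hl v ⟨c, hc⟩ ⟨d, hd⟩ with h1 | h1 | h1 | h1 | ⟨h1, h2, h3⟩
  · exact h.eq_zero_of_w₁ b d h1
  · exact h.eq_zero_of_w₂ a c h1
  · exact h.eq_zero_of_add_lt₁ u v b d h1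
  · exact h.eq_zero_of_add_lt₂ u v a c h1
  · exact h.eq_zero_of_add_eq h1 h2 h3

theorem mem_radical_of_lie (h : IsNormalized ω) {x y z : Melikian F} (n : ℤ) (hn : ¬ 5 ∣ n)
    (hx : ω x = 0) (hy : ω y = 0) (hz : ⁅x, y⁆ = n • z) : ω z = 0 := by
  have h0 := h.lie_eq_zero hx hy
  rwa [hz, ← Int.cast_smul_eq_zsmul F, map_smul,
    smul_eq_zero_iff_right ((intCast_eq_zero_iff_dvd _).not.mpr hn)] at h0

/-- Low elements generate `x₁^(4) ∂₁` and `x₂^(4) ∂₂`, which raise `x₁ x₂` to the top of `𝒪`. From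
there `(∂₁)~`, `(∂₂)~`, `x₂` and `x₁` reach the tops of the other four copies. The integer
coefficients must be nonzero mod 5. -/
theorem top_mem_radical (h : IsNormalized ω) (u : Fin 5) : ω (e F u 4 4) = 0 := by
  have p₁ : ω (e F 1 4 0) = 0 := by
    refine h.mem_radical_of_lie 2 (by decide) (h.mem_radical_of_isLow (u := 1) (a := 2) (b := 0)
      (by decide)) (h.mem_radical_of_isLow (u := 1) (a := 3) (b := 0) (by decide)) ?_
    rw [e, e, e, lie_emb_one (d₂_X_zero _), ← map_zsmul]
    congr 1
    simp [d₁_X, X_mul_X, k₁, Nat.choose]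
    ring
  have p₂ : ω (e F 2 0 4) = 0 := by
    refine h.mem_radical_of_lie 2 (by decide) (h.mem_radical_of_isLow (u := 2) (a := 0) (b := 2)
      (by decide)) (h.mem_radical_of_isLow (u := 2) (a := 0) (b := 3) (by decide)) ?_
    rw [e, e, e, lie_emb_two (d₁_X_zero _), ← map_zsmul]
    congr 1
    simp [d₂_X, X_mul_X, k₂, Nat.choose]
    ring
  -- The coefficient is `1 - 2 · 4`: the `4` comes from `x₁^(3) x₁ = 4 x₁^(4)`, the `-2` from the
  -- divergence term.
  have q₁ : ω (e F 0 4 1) = 0 := by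
    refine h.mem_radical_of_lie (-7) (by decide) p₁
      (h.mem_radical_of_isLow (u := 0) (a := 1) (b := 1) (by decide)) ?_
    rw [e, e, e, lie_emb_one (d₂_X_zero _), ← map_zsmul]
    congr 1
    simp [d₁_X, X_mul_X, k₁, Nat.choose]
    ring
  have q : ω (e F 0 4 4) = 0 := by
    refine h.mem_radical_of_lie (-7) (by decide) p₂ q₁ ?_
    rw [e, e, e, lie_emb_two (d₁_X_zero _), ← map_zsmul]
    congr 1
    simp [d₂_X, X_mul_X, k₂, Nat.choose]
    ring
  fin_cases u
  · exact q
  · refine h.mem_radical_of_lie 1 (by decide) q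
      (h.mem_radical_of_isLow (u := 3) (a := 0) (b := 0) (by decide)) ?_
    rw [e, e, e, lie_emb_zero_three, X_mul_X]
    simp
  · refine h.mem_radical_of_lie 1 (by decide) q
      (h.mem_radical_of_isLow (u := 4) (a := 0) (b := 0) (by decide)) ?_
    rw [e, e, e, lie_emb_zero_four, X_mul_X]
    simp
  -- Here `6 = 2 (4 - 1)`; the other component of the bracket vanishes because `x₂ · x₂^(4) = 0`.
  · refine h.mem_radical_of_lie 6 (by decide) q
      (h.mem_radical_of_isLow (u := 0) (a := 0) (b := 1) (by decide)) ?_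
    rw [e, e, e, lie_emb_zero_zero]
    simp [d₁_X, d₂_X, X_mul_X, Nat.choose, X_zero_zero, X_eq_zero]
    rw [← map_zsmul]
    congr 1
    ring
  · refine h.mem_radical_of_lie (-6) (by decide) q
      (h.mem_radical_of_isLow (u := 0) (a := 1) (b := 0) (by decide)) ?_
    rw [e, e, e, lie_emb_zero_zero]
    simp [d₁_X, d₂_X, X_mul_X, Nat.choose, X_zero_zero, X_eq_zero]
    rw [← map_zsmul, ← map_neg]
    congr 1
    ring

theorem eq_zero (h : IsNormalized ω) : ω = 0 := by
  have h1 : ∀ u a, a < 5 → ω (e F u a 4) = 0 := by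
    intro u a ha
    induction Nat.lt_succ_iff.mp ha using Nat.decreasingInduction with
    | self => exact h.top_mem_radical u
    | of_succ a ha' ih =>
      rw [← lie_d₁_e_succ u ha']
      exact h.lie_eq_zero h.d₁_mem_radical (ih (by omega))
  refine linearMap_ext fun u a b ha hb => ?_
  induction Nat.lt_succ_iff.mp hb using Nat.decreasingInduction with
  | self => exact h1 u a ha
  | of_succ b hb' ih =>
    rw [← lie_d₂_e_succ u a hb']
    exact h.lie_eq_zero h.d₂_mem_radical (ih (by omega))

end IsNormalized

/-- Every cocycle on `ℳ(1,1)` with coefficients in a trivial module is a coboundary. -/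
theorem exists_eq_lie {ω : Melikian F →ₗ[F] Melikian F →ₗ[F] V} (h : IsTrivialCocycle ω) :
    ∃ f : Melikian F →ₗ[F] V, ∀ x y, ω x y = f ⁅x, y⁆ := by
  obtain ⟨f, η, hη, hf⟩ := exists_normalized h
  refine ⟨f, fun x y => ?_⟩
  rw [← sub_eq_zero, ← hf, hη.eq_zero, LinearMap.zero_apply, LinearMap.zero_apply]

end Melikian

/-! ### Second cohomology, central extensions and the derived algebra -/

namespace Melikian

variable {F : Type*} [Field F] [CharP F 5]

/-- This is perfectness of `ℳ`: a basis vector that is not top in both variables is a bracket with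
`∂₁` or `∂₂`, and a top one has a nonzero torus weight. -/
theorem mem_of_lie_mem {S : Submodule F (Melikian F)} (hS : ∀ x y : Melikian F, ⁅x, y⁆ ∈ S)
    (z : Melikian F) : z ∈ S := by
  have key : ∀ u a b : Fin 5, a.val < 4 ∨ b.val < 4 ∨ ¬ 5 ∣ w₁ u a.val ∨ ¬ 5 ∣ w₂ u b.val := by
    decide
  rw [← sum_smul_e z]
  refine sum_mem fun u _ => sum_mem fun c _ => S.smul_mem _ ?_
  rcases key u c.1 c.2 with h | h | h | h
  · rw [← lie_d₁_e_succ u h]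
    exact hS _ _
  · rw [← lie_d₂_e_succ u _ h]
    exact hS _ _
  · have := hS (e F 1 1 0) (e F u c.1.val c.2.val)
    rwa [lie_t₁_e, S.smul_mem_iff ((intCast_eq_zero_iff_dvd _).not.mpr h)] at this
  · have := hS (e F 2 0 1) (e F u c.1.val c.2.val)
    rwa [lie_t₂_e, S.smul_mem_iff ((intCast_eq_zero_iff_dvd _).not.mpr h)] at this

theorem lieH2_eq_bot : LieH2 F (Melikian F) (TrivialLieModule F (Melikian F) F) = ⊥ := by
  rw [LieH2, eq_bot_iff, Submodule.map_le_iff_le_comap]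
  rintro _ ⟨c, hc, rfl⟩
  rw [Submodule.mem_comap, Submodule.mem_bot, Submodule.mkQ_apply, Submodule.Quotient.mk_eq_zero]
  have hω : IsTrivialCocycle c.1 :=
    ⟨c.2, (LieModule.Cohomology.mem_twoCocycle_iff_of_trivial _ _ _ c).mp hc⟩
  obtain ⟨f, hf⟩ := exists_eq_lie hω
  -- For trivial coefficients the differential sends `f` to `-f ⁅x, y⁆`, hence the sign.
  refine ⟨LieModule.Cohomology.d₁₂ _ _ _ (-f), ⟨-f, rfl⟩, ?_⟩
  ext x y
  refine (LieModule.Cohomology.d₁₂_apply_apply_ofTrivial _ _ _ (-f) x y).trans ?_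
  rw [LinearMap.neg_apply, neg_neg, ← hf]
  rfl

/-- The defect of a linear section is a cocycle with values in the kernel, on which the action is
trivial by centrality. If it equals `f ⁅x, y⁆`, adding `f` to the section makes it a homomorphism.
-/
theorem exists_lie_section {E : Type*} [LieRing E] [LieAlgebra F E] (p : E →ₗ⁅F⁆ Melikian F)
    (hp : Function.Surjective p) (hc : p.ker ≤ LieAlgebra.center F E) :
    ∃ s : Melikian F →ₗ⁅F⁆ E, ∀ x, p (s x) = x := by
  obtain ⟨σ, hσ⟩ := (p : E →ₗ[F] Melikian F).exists_rightInverse_of_surjective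
    (LinearMap.range_eq_top.mpr hp)
  have hσ' : ∀ x, p (σ x) = x := fun x => LinearMap.congr_fun hσ x
  have central : ∀ z ∈ LinearMap.ker (p : E →ₗ[F] Melikian F), ∀ y : E, ⁅y, z⁆ = 0 :=
    fun z hz => (LieModule.mem_maxTrivSubmodule F E E z).mp (hc (p.mem_ker.mpr hz))
  let defect : Melikian F →ₗ[F] Melikian F →ₗ[F] LinearMap.ker (p : E →ₗ[F] Melikian F) :=
    LinearMap.mk₂ F (fun x y => ⟨⁅σ x, σ y⁆ - σ ⁅x, y⁆, by
        rw [LinearMap.mem_ker]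
        change p _ = 0
        rw [map_sub, LieHom.map_lie, hσ', hσ', hσ', sub_self]⟩)
      (fun x y z => Subtype.ext (by simp; abel))
      (fun r x y => Subtype.ext (by simp [smul_sub]))
      (fun x y z => Subtype.ext (by simp; abel))
      (fun r x y => Subtype.ext (by simp [smul_sub]))
  have hdef : ∀ x y, ((defect x y : _) : E) = ⁅σ x, σ y⁆ - σ ⁅x, y⁆ := fun _ _ => rfl
  -- The defect is central, so it disappears inside a further bracket; the cocycle identity then
  -- reduces to the Jacobi identities of `E` and `ℳ`.
  have hlie : ∀ x y z, ⁅σ x, ⁅σ y, σ z⁆⁆ = ⁅σ x, σ ⁅y, z⁆⁆ := by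
    intro x y z
    have := central _ (defect y z).2 (σ x)
    rwa [hdef, lie_sub, sub_eq_zero] at this
  have hω : IsTrivialCocycle defect := by
    refine ⟨fun x => Subtype.ext ?_, fun x y z => Subtype.ext ?_⟩
    · simp [hdef]
    · rw [Submodule.coe_add, hdef, hdef, hdef, ← hlie, ← lie_skew (σ ⁅x, y⁆), ← hlie, ← hlie,
        lie_skew, leibniz_lie, leibniz_lie x y z, map_add]
      abel
  obtain ⟨f, hf⟩ := exists_eq_lie hω
  have hs : ∀ x y, ⁅σ x + f x, σ y + f y⁆ = σ ⁅x, y⁆ + (f ⁅x, y⁆ : E) := by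
    intro x y
    rw [← hf, hdef, add_sub_cancel, lie_add, central _ (f y).2, add_zero, add_lie,
      ← lie_skew (f x : E), central _ (f x).2, neg_zero, add_zero]
  refine ⟨{ toLinearMap := σ + (Submodule.subtype _).comp f, map_lie' := ?_ }, fun x => ?_⟩
  · intro x y
    exact (hs x y).symm
  · change p (σ x + f x) = x
    have : p (f x : E) = 0 := (f x).2
    rw [map_add, hσ', this, add_zero]

/-- The derived algebra is the image of a section `s` of the quotient map: brackets in `L` only
depend on the images in `ℳ`, which gives one inclusion, and perfectness of `ℳ` gives the other. The
image of `s` is a complement of the kernel, which is the center. -/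
theorem derivedSeries_equiv_and_isCompl {L : Type*} [LieRing L] [LieAlgebra F L]
    (φ : (L ⧸ LieAlgebra.center F L) ≃ₗ⁅F⁆ Melikian F) :
    Nonempty (LieAlgebra.derivedSeries F L 1 ≃ₗ⁅F⁆ Melikian F) ∧
      IsCompl (LieAlgebra.derivedSeries F L 1) (LieAlgebra.center F L) := by
  let p : L →ₗ⁅F⁆ Melikian F :=
    { toLinearMap := φ.toLinearEquiv.toLinearMap ∘ₗ (LieAlgebra.center F L).toSubmodule.mkQ
      map_lie' := fun {x y} => φ.map_lie (LieSubmodule.Quotient.mk x) (LieSubmodule.Quotient.mk y) }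
  have hp : ∀ x, p x = φ (LieSubmodule.Quotient.mk x) := fun _ => rfl
  have hker : ∀ x, p x = 0 ↔ x ∈ LieAlgebra.center F L := by
    intro x
    rw [hp, ← LieSubmodule.Quotient.mk_eq_zero', ← map_zero φ]
    exact φ.injective.eq_iff
  obtain ⟨s, hs⟩ := exists_lie_section p
    (φ.surjective.comp (LieSubmodule.Quotient.surjective_mk' _))
    fun x hx => (hker x).mp (p.mem_ker.mp hx)
  have hdiff : ∀ x, x - s (p x) ∈ LieAlgebra.center F L := by
    intro x
    rw [← hker, map_sub, hs, sub_self]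
  have hlie : ∀ x y : L, ⁅x, y⁆ = s ⁅p x, p y⁆ := by
    intro x y
    have h1 := (LieModule.mem_maxTrivSubmodule F L L _).mp (hdiff y) x
    have h2 := (LieModule.mem_maxTrivSubmodule F L L _).mp (hdiff x) (s (p y))
    rw [lie_sub, sub_eq_zero] at h1 h2
    rw [h1, ← lie_skew, h2, lie_skew, LieHom.map_lie]
  have hspan : ∀ d, d ∈ LieAlgebra.derivedSeries F L 1 ↔
      d ∈ Submodule.span F {⁅x, y⁆ | (x : L) (y : L)} :=
    SetLike.ext_iff.mp (LieAlgebra.coe_derivedSeries_one_eq F L)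
  have hmem : ∀ z, s z ∈ LieAlgebra.derivedSeries F L 1 := by
    refine mem_of_lie_mem
      (S := (LieAlgebra.derivedSeries F L 1).toSubmodule.comap (s : Melikian F →ₗ[F] L)) ?_
    intro x y
    rw [Submodule.mem_comap, LieSubmodule.mem_toSubmodule, hspan]
    exact Submodule.subset_span ⟨s x, s y, (s.map_lie x y).symm⟩
  have hrange : ∀ d ∈ LieAlgebra.derivedSeries F L 1, s (p d) = d := by
    intro d hd
    rw [hspan] at hd
    induction hd using Submodule.span_induction with
    | mem d hd =>
      obtain ⟨x, y, rfl⟩ := hd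
      rw [hlie, hs]
    | zero => rw [map_zero, map_zero]
    | add x y _ _ hx hy => rw [map_add, map_add, hx, hy]
    | smul r x _ hx => rw [map_smul, map_smul, hx]
  refine ⟨⟨LieEquiv.ofBijective (p.comp (LieAlgebra.derivedSeries F L 1).incl) ⟨?_, ?_⟩⟩, ?_, ?_⟩
  · intro x y hxy
    apply Subtype.ext
    rw [← hrange x x.2, ← hrange y y.2]
    exact congrArg s hxy
  · exact fun z => ⟨⟨s z, hmem z⟩, hs z⟩
  · rw [disjoint_iff_inf_le]
    intro d hd
    rw [LieSubmodule.mem_inf] at hd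
    rw [LieSubmodule.mem_bot, ← hrange d hd.1, (hker d).mpr hd.2, map_zero]
  · rw [codisjoint_iff_le_sup]
    intro x _
    rw [LieSubmodule.mem_sup]
    exact ⟨s (p x), hmem _, x - s (p x), hdiff x, add_sub_cancel _ _⟩

end Melikian

theorem mainTheorem8 {F : Type*} [Field F] [IsAlgClosed F] [CharP F 5] :
    LieH2 F (Melikian F) (TrivialLieModule F (Melikian F) F) = ⊥ ∧
    (∀ (E : Type*) [LieRing E] [LieAlgebra F E] (p : E →ₗ⁅F⁆ Melikian F),
      Function.Surjective p → p.ker ≤ LieAlgebra.center F E →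
        ∃ s : Melikian F →ₗ⁅F⁆ E, ∀ x, p (s x) = x) ∧
    (∀ (L : Type*) [LieRing L] [LieAlgebra F L],
      Nonempty ((L ⧸ LieAlgebra.center F L) ≃ₗ⁅F⁆ Melikian F) →
        Nonempty (LieAlgebra.derivedSeries F L 1 ≃ₗ⁅F⁆ Melikian F) ∧
        IsCompl (LieAlgebra.derivedSeries F L 1) (LieAlgebra.center F L)) :=
  ⟨Melikian.lieH2_eq_bot, fun _ _ _ p hp hc => Melikian.exists_lie_section p hp hc,
    fun _ _ _ ⟨φ⟩ => Melikian.derivedSeries_equiv_and_isCompl φ⟩
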